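/- Let $F$ be a field, let $X$ and $Y$ be finite sets with dissimilarities $d_X:X\times X\to\mathbb R_{\ge 0}$, $d_Y:Y\times Y\to\mathbb R_{\ge 0}$ (functions with $d(x,x)=0$ for all $x$), and let $k\ge 0$. For $r\in\mathbb R$ let $X_r$ be the Vietoris–Rips complex whose simplices are the non-empty sets of points with all pairwise dissimilarities $\le r$, and let $H_k(X)$ be the persistence vector space $r\mapsto H_k(X_r;F)$ with the maps induced by inclusion; similarly $H_k(Y)$. An $\varepsilon$-shift map $f:V\to W$ of persistence vector spaces is a family of linear maps $f_r:V_r\to W_{r+\varepsilon}$ commuting with the structure maps; an $\varepsilon$-interleaving is a pair of $\varepsilon$-shift maps $f:V\to W$, $g:W\to V$ such that $g_{r+\varepsilon}f_r$ and $f_{r+\varepsilon}g_r$ are the structure maps $V_r\to V_{r+2\varepsilon}$ and $W_r\to W_{r+2\varepsilon}$ for all $r$; and $d_{\mathrm I}(V,W)\in[0,\infty]$ is the infimum of all $\varepsilon\ge 0$ for which an $\varepsilon$-interleaving exists. The persistence pairs $(b,d)$, with $b<d\le\infty$, of a persistence vector space are the birth and death times of the summands of a decomposition into interval modules supported on $[b,d)$.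 Assume that $\varepsilon=d_{\mathrm I}(H_k(X),H_k(Y))$ is finite. Then $H_k(X)$ and $H_k(Y)$ have such interval decompositions, and there is an $\varepsilon$-interleaving between them. Moreover, for all interval decompositions of $H_k(X)$ and of $H_k(Y)$ and every $\varepsilon$-interleaving $(f,g)$ between $H_k(X)$ and $H_k(Y)$, one can assign to each persistence pair $(b,d)$ of $H_k(X)$ with $|d-b|>4\varepsilon$ a persistence pair $(b',d')$ of $H_k(Y)$, distinct pairs (counted with multiplicity) receiving distinct pairs, such that: 1. $(b',d')$ corresponds to $(b,d)$ under $f$: the image in $H_k(Y_{b+\varepsilon})$, under $f_b$, of the basis vector of $H_k(X_b)$ born with the summand $(b,d)$ has a non-zero component along the summand $(b',d')$; 2. $b'\le b+\varepsilon$ and $d'\ge d-\varepsilon$; 3. $|d'-b'|>2\varepsilon$, that is, $(b',d')$ is selected by the procedure that selects the pairs of $H_k(Y)$ of length greater than $2\varepsilon$. -/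

import Mathlib

open scoped NNReal ENNReal

universe u v w w'

noncomputable section

/-- A persistence vector space over the field `F`, indexed by the real line. -/
structure PersistenceSpace (F : Type v) [Field F] where
  /-- the vector space at parameter `r` -/
  space : ℝ → Type w
  [addCommGroup : ∀ r, AddCommGroup (space r)]
  [module : ∀ r, Module F (space r)]
  /-- the structure map from parameter `r` to parameter `s` -/
  map : ∀ {r s : ℝ}, r ≤ s → space r →ₗ[F] space s
  map_refl : ∀ (r : ℝ) (x : space r), map (le_refl r) x = x
  map_map : ∀ {r s t : ℝ} (hrs : r ≤ s) (hst : s ≤ t) (x : space r),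
    map hst (map hrs x) = map (hrs.trans hst) x

attribute [instance] PersistenceSpace.addCommGroup PersistenceSpace.module

/-- An `ε`-shift map `V → W`: linear maps `V_r → W_{r+ε}` commuting with the structure maps. -/
structure ShiftMap {F : Type v} [Field F] (V : PersistenceSpace.{v, w} F)
    (W : PersistenceSpace.{v, w'} F) (ε : ℝ≥0) where
  app : ∀ r : ℝ, V.space r →ₗ[F] W.space (r + ε)
  naturality : ∀ {r s : ℝ} (h : r ≤ s) (x : V.space r),
    app s (V.map h x) = W.map (add_le_add_left h (ε : ℝ)) (app r x)

theorem le_add_shift_twice (r : ℝ) (ε : ℝ≥0) : r ≤ r + ε + ε := by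
  have := ε.coe_nonneg
  linarith

/-- An `ε`-interleaving between `V` and `W`: two `ε`-shift maps whose composites are the
structure maps of `V` and of `W` from parameter `r` to parameter `r + 2ε`. -/
structure Interleaving {F : Type v} [Field F] (V : PersistenceSpace.{v, w} F)
    (W : PersistenceSpace.{v, w'} F) (ε : ℝ≥0) where
  toRight : ShiftMap V W ε
  toLeft : ShiftMap W V ε
  left_comp : ∀ (r : ℝ) (x : V.space r),
    toLeft.app (r + ε) (toRight.app r x) = V.map (le_add_shift_twice r ε) x
  right_comp : ∀ (r : ℝ) (y : W.space r),
    toRight.app (r + ε) (toLeft.app r y) = W.map (le_add_shift_twice r ε) y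

/-- The interleaving distance; it is `∞` if there is no interleaving at all. -/
def interleavingDist {F : Type v} [Field F] (V : PersistenceSpace.{v, w} F)
    (W : PersistenceSpace.{v, w'} F) : ℝ≥0∞ :=
  ⨅ (ε : ℝ≥0) (_ : Nonempty (Interleaving V W ε)), (ε : ℝ≥0∞)

/-- A decomposition of `V` into interval summands `[birth i, death i)`. The family
`birth, death` is the multiset of persistence pairs (deaths may be `∞`), and
`basis r` is the basis of `V_r` given by the summands that are alive at `r`. -/
structure Barcode {F : Type v} [Field F] (V : PersistenceSpace.{v, w} F) where
  ι : Type
  birth : ι → ℝ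
  death : ι → EReal
  birth_lt_death : ∀ i, (birth i : EReal) < death i
  basis : ∀ r : ℝ, Module.Basis {i : ι // birth i ≤ r ∧ (r : EReal) < death i} F (V.space r)
  map_basis_of_lt : ∀ {r s : ℝ} (h : r ≤ s) (i : ι) (hb : birth i ≤ r) (hd : (s : EReal) < death i),
    V.map h (basis r ⟨i, hb, (EReal.coe_le_coe_iff.2 h).trans_lt hd⟩) = basis s ⟨i, hb.trans h, hd⟩
  map_basis_of_le : ∀ {r s : ℝ} (h : r ≤ s) (i : ι) (hr : birth i ≤ r ∧ (r : EReal) < death i),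
    death i ≤ (s : EReal) → V.map h (basis r ⟨i, hr⟩) = 0

namespace Barcode

variable {F : Type v} [Field F] {V : PersistenceSpace.{v, w} F} {W : PersistenceSpace.{v, w'} F}

/-- The length `d - b` of a persistence pair, possibly `∞`. -/
def length (D : Barcode V) (i : D.ι) : EReal := D.death i - (D.birth i : EReal)

/-- The selection procedure with parameter `ε`: keep the pairs of length greater than `2ε`. -/
def selected (D : Barcode V) (ε : ℝ≥0) : Set D.ι :=
  {i | ((2 * ε : ℝ) : EReal) < D.length i}

/-- The homology vector that appears at the birth of the pair `i`. -/
def birthVector (D : Barcode V) (i : D.ι) : V.space (D.birth i) :=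
  D.basis (D.birth i) ⟨i, le_refl _, D.birth_lt_death i⟩

/-- The pair `i` of `V` corresponds to the pair `j` of `W` under the shift map `f`: the image
under `f` of the vector born with `i` has a non-zero component along the interval summand `j`. -/
def Corresponds (D : Barcode V) (E : Barcode W) {ε : ℝ≥0} (f : ShiftMap V W ε)
    (i : D.ι) (j : E.ι) : Prop :=
  ∃ h : E.birth j ≤ D.birth i + ε ∧ ((D.birth i + ε : ℝ) : EReal) < E.death j,
    (E.basis (D.birth i + ε)).repr (f.app (D.birth i) (D.birthVector i)) ⟨j, h⟩ ≠ 0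

end Barcode

/-- A dissimilarity on `X` (neither symmetry nor the triangle inequality is required). -/
structure Dissimilarity (X : Type u) where
  dist : X → X → ℝ≥0
  dist_self : ∀ x, dist x x = 0

/-- The quotient `Z / (Z ∩ B)` of two subspaces (which is `Z / B` when `B ≤ Z`). -/
def Subquotient {F : Type v} [Field F] {M : Type w} [AddCommGroup M] [Module F M]
    (Z B : Submodule F M) : Type w :=
  Z ⧸ B.submoduleOf Z

instance {F : Type v} [Field F] {M : Type w} [AddCommGroup M] [Module F M]
    (Z B : Submodule F M) : AddCommGroup (Subquotient Z B) :=
  inferInstanceAs (AddCommGroup (Z ⧸ B.submoduleOf Z))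

instance {F : Type v} [Field F] {M : Type w} [AddCommGroup M] [Module F M]
    (Z B : Submodule F M) : Module F (Subquotient Z B) :=
  inferInstanceAs (Module F (Z ⧸ B.submoduleOf Z))

/-- The map of subquotients induced by inclusions of subspaces. -/
def Subquotient.map {F : Type v} [Field F] {M : Type w} [AddCommGroup M] [Module F M]
    {Z B Z' B' : Submodule F M} (hZ : Z ≤ Z') (hB : B ≤ B') :
    Subquotient Z B →ₗ[F] Subquotient Z' B' :=
  Submodule.mapQ (B.submoduleOf Z) (B'.submoduleOf Z') (Submodule.inclusion hZ) fun _ hx => hB hx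

namespace VietorisRips

variable (F : Type v) [Field F] {X : Type u} [LinearOrder X]

/-- The simplicial boundary map `∂ [x₀,…,x_{k+1}] = ∑ᵢ (-1)ⁱ [x₀,…,x̂ᵢ,…,x_{k+1}]`. A `k`-simplex
is a set of `k + 1` vertices, listed in increasing order for the auxiliary order of `X`. -/
def boundary (X : Type u) [LinearOrder X] (k : ℕ) :
    ((Fin (k + 2) ↪o X) →₀ F) →ₗ[F] ((Fin (k + 1) ↪o X) →₀ F) :=
  Finsupp.linearCombination F fun x : Fin (k + 2) ↪o X =>
    ∑ i : Fin (k + 2), Finsupp.single ((Fin.succAboveOrderEmb i).trans x) ((-1 : F) ^ (i : ℕ))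

variable (d : Dissimilarity X)

/-- The `k`-chains of the Vietoris-Rips complex at parameter `r`: combinations of the
`k`-simplices whose pairwise dissimilarities are at most `r`. -/
def chains (r : ℝ) (k : ℕ) : Submodule F ((Fin (k + 1) ↪o X) →₀ F) :=
  Finsupp.supported F F {x | ∀ i j, (d.dist (x i) (x j) : ℝ) ≤ r}

/-- The `k`-cycles at parameter `r` (for `k = 0` every chain is a cycle). -/
def cycles (r : ℝ) : (k : ℕ) → Submodule F ((Fin (k + 1) ↪o X) →₀ F)
  | 0 => chains F d r 0
  | k + 1 => chains F d r (k + 1) ⊓ LinearMap.ker (boundary F X k)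

/-- The `k`-boundaries at parameter `r`. -/
def boundaries (r : ℝ) (k : ℕ) : Submodule F ((Fin (k + 1) ↪o X) →₀ F) :=
  (chains F d r (k + 1)).map (boundary F X k)

theorem chains_mono {r s : ℝ} (h : r ≤ s) (k : ℕ) : chains F d r k ≤ chains F d s k :=
  Finsupp.supported_mono fun _ hx i j => (hx i j).trans h

theorem cycles_mono {r s : ℝ} (h : r ≤ s) (k : ℕ) : cycles F d r k ≤ cycles F d s k := by
  cases k with
  | zero => exact chains_mono F d h 0
  | succ k => exact inf_le_inf_right _ (chains_mono F d h (k + 1))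

theorem boundaries_mono {r s : ℝ} (h : r ≤ s) (k : ℕ) :
    boundaries F d r k ≤ boundaries F d s k :=
  Submodule.map_mono (chains_mono F d h (k + 1))

theorem boundary_boundary (k : ℕ) (c : (Fin (k + 3) ↪o X) →₀ F) :
    boundary F X k (boundary F X (k + 1) c) = 0 := by
  suffices h : boundary F X k ∘ₗ boundary F X (k + 1) = 0 from LinearMap.congr_fun h c
  refine Finsupp.lhom_ext' fun x => LinearMap.ext_ring ?_
  simp only [boundary, LinearMap.comp_apply, Finsupp.lsingle_apply,
    Finsupp.linearCombination_single, one_smul, map_sum, Finset.smul_sum, Finsupp.smul_single,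
    LinearMap.zero_apply, smul_eq_mul]
  rw [← Fintype.sum_prod_type']
  refine Finset.sum_involution (fun p _ => (p.1.succAbove p.2, p.2.predAbove p.1)) ?_ ?_ ?_ ?_
  · rintro ⟨i, j⟩ -
    have h1 : (Fin.succAboveOrderEmb (j.predAbove i)).trans
        ((Fin.succAboveOrderEmb (i.succAbove j)).trans x) =
        (Fin.succAboveOrderEmb j).trans ((Fin.succAboveOrderEmb i).trans x) := by
      ext m
      simp [Fin.succAbove_succAbove_succAbove_predAbove]
    have h2 := Fin.neg_one_pow_succAbove_add_predAbove (R := F) i j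
    simp only [pow_add] at h2
    simp only [h1, ← Finsupp.single_add, h2]
    simp
  · rintro ⟨i, j⟩ - _ h
    exact Fin.succAbove_ne i j (congrArg Prod.fst h)
  · simp
  · rintro ⟨i, j⟩ -
    simp [Fin.succAbove_succAbove_predAbove, Fin.predAbove_predAbove_succAbove]

theorem boundaries_le_cycles (r : ℝ) (k : ℕ) : boundaries F d r k ≤ cycles F d r k := by
  have hc : boundaries F d r k ≤ chains F d r k := by
    unfold boundaries chains
    rw [Finsupp.supported_eq_span_single, Submodule.map_span, Submodule.span_le]
    rintro _ ⟨_, ⟨x, hx, rfl⟩, rfl⟩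
    simp only [boundary, Finsupp.linearCombination_single, one_smul]
    exact Submodule.sum_mem _ fun i _ =>
      Finsupp.single_mem_supported F _ fun a b => hx _ _
  cases k with
  | zero => exact hc
  | succ k =>
    refine le_inf hc ?_
    rintro _ ⟨c, -, rfl⟩
    exact boundary_boundary F k c

/-- The simplicial homology `H_k(X; r)` of the Vietoris-Rips complex at parameter `r`. -/
abbrev Homology (r : ℝ) (k : ℕ) : Type (max u v) :=
  Subquotient (cycles F d r k) (boundaries F d r k)

/-- The map `H_k(X; r) → H_k(X; s)` induced by the inclusion of complexes. -/
def homologyMap {r s : ℝ} (h : r ≤ s) (k : ℕ) : Homology F d r k →ₗ[F] Homology F d s k :=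
  Subquotient.map (cycles_mono F d h k) (boundaries_mono F d h k)

/-- The persistent homology `H_k(X)` of the Vietoris-Rips filtration, coefficients in `F`. -/
def persistentHomology (k : ℕ) : PersistenceSpace.{v, max u v} F where
  space r := Homology F d r k
  map h := homologyMap F d h k
  map_refl r x := by
    obtain ⟨x, rfl⟩ := Submodule.Quotient.mk_surjective _ x
    rfl
  map_map hrs hst x := by
    obtain ⟨x, rfl⟩ := Submodule.Quotient.mk_surjective _ x
    rfl

end VietorisRips

end

/-! Homology at every parameter is a subquotient of one fixed finite-dimensional space of chains,
cut out by two filtrations, the cycles and the boundaries. Two chains of subspaces have a common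
adapted basis (`exists_adapted_basis`); a basis vector that enters the cycles at `b` and the
boundaries at `d > b` spans an interval summand on `[b, d)`.

Homology changes only at the finitely many dissimilarity values. An interleaving at some `δ`
slightly above the infimum `ε` can therefore be lowered to `ε` itself
(`Interleaving.nonempty_of_gap`), so the infimum is attained.

For the matching, take a pair `i` with `b_i + 2ε < d_i`, expand the image under `f` of its birth
vector in the barcode of `Y`, and apply `g`. As `g ∘ f` is a structure map, the coefficient along
`i'` is `1` if `i = i'` and `0` otherwise, whenever `d_i ≤ d_{i'}`. Summands of `Y` that die before
`d_i - ε` contribute nothing to it. Discarding them, the product of the matrices of `f` and `g` is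
unitriangular for the order by death, and Hall's theorem yields distinct representatives
(`exists_injective_mem_of_unitriangular`). Length `> 4ε` is needed only so that the representative
is longer than `2ε`. -/

/-! ### Bases adapted to two chains of subspaces -/

section AdaptedBasis

variable {F C : Type*} [Field F] [AddCommGroup C] [Module F C]

/-- The largest member of the chain not containing `H` meets `H` in a proper subspace; any
hyperplane of `H` above this intersection works for all smaller members too. -/
theorem Submodule.exists_covBy_of_isChain [FiniteDimensional F C] {𝓩 : Set (Submodule F C)}
    (hZ : IsChain (· ≤ ·) 𝓩) {H : Submodule F C} (hH : H ≠ ⊥) :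
    ∃ H' : Submodule F C, H' ⋖ H ∧ ∀ Z ∈ 𝓩, H ≤ Z ∨ Z ⊓ H ≤ H' := by
  obtain ⟨M, hMH, hM⟩ : ∃ M < H, ∀ Z ∈ 𝓩, H ≤ Z ∨ Z ⊓ H ≤ M := by
    by_cases hne : {Z ∈ 𝓩 | ¬H ≤ Z}.Nonempty
    · obtain ⟨Z₀, ⟨hZ₀, hHZ₀⟩, hmax⟩ := WellFounded.has_min
        (wellFounded_gt (α := Submodule F C)) _ hne
      refine ⟨Z₀ ⊓ H, inf_lt_right.2 hHZ₀, fun Z hZm => ?_⟩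
      by_cases hHZ : H ≤ Z
      · exact Or.inl hHZ
      · refine Or.inr (inf_le_inf_right _ ?_)
        rcases hZ.total hZm hZ₀ with h | h
        · exact h
        · exact (eq_of_le_of_not_lt h (hmax Z ⟨hZm, hHZ⟩)).ge
    · refine ⟨⊥, bot_lt_iff_ne_bot.2 hH, fun Z hZm => Or.inl ?_⟩
      by_contra h
      exact hne ⟨Z, hZm, h⟩
  obtain ⟨H', hle, hcov⟩ := exists_le_covBy_of_lt hMH
  exact ⟨H', hcov, fun Z hZm => (hM Z hZm).imp_right fun h => h.trans hle⟩

/-- Take `v` in the smallest member of the chain that meets `H` outside `H'`; all larger members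
then contain it. -/
theorem Submodule.exists_mem_sdiff_of_isChain [FiniteDimensional F C] {𝓑 : Set (Submodule F C)}
    (hB : IsChain (· ≤ ·) 𝓑) {H H' : Submodule F C} (hH : H' < H) :
    ∃ v ∈ H, v ∉ H' ∧ ∀ B ∈ 𝓑, v ∈ B ∨ B ⊓ H ≤ H' := by
  by_cases hne : {B ∈ 𝓑 | ¬B ⊓ H ≤ H'}.Nonempty
  · obtain ⟨B₀, ⟨hB₀, hHB₀⟩, hmin⟩ := WellFounded.has_min
      (wellFounded_lt (α := Submodule F C)) _ hne
    obtain ⟨v, ⟨hvB, hvH⟩, hv⟩ := SetLike.not_le_iff_exists.1 hHB₀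
    refine ⟨v, hvH, hv, fun B hBm => ?_⟩
    by_cases hBH : B ⊓ H ≤ H'
    · exact Or.inr hBH
    · refine Or.inl ?_
      rcases hB.total hBm hB₀ with h | h
      · exact (eq_of_le_of_not_lt h (hmin B ⟨hBm, hBH⟩)).ge hvB
      · exact h hvB
  · obtain ⟨v, hvH, hv⟩ := SetLike.exists_of_lt hH
    refine ⟨v, hvH, hv, fun B hBm => Or.inr ?_⟩
    by_contra h
    exact hne ⟨B, hBm, h⟩

/-- Two chains of subspaces have a common adapted basis. -/
theorem exists_adapted_linearIndepOn [FiniteDimensional F C] {𝓩 𝓑 : Set (Submodule F C)}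
    (hZ : IsChain (· ≤ ·) 𝓩) (hB : IsChain (· ≤ ·) 𝓑) (H : Submodule F C) :
    ∃ S : Set C, S ⊆ H ∧ LinearIndepOn F id S ∧ H ≤ Submodule.span F S ∧
      ∀ U ∈ 𝓩 ∪ 𝓑, U ⊓ H ≤ Submodule.span F (S ∩ U) := by
  induction H using WellFoundedLT.induction with
  | ind H ih =>
    by_cases hH : H = ⊥
    · subst hH
      exact ⟨∅, by simp, linearIndepOn_empty F id, by simp, by simp⟩
    obtain ⟨H', hcov, hH'⟩ := Submodule.exists_covBy_of_isChain hZ hH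
    obtain ⟨v, hvH, hv, hvB⟩ := Submodule.exists_mem_sdiff_of_isChain hB hcov.lt
    obtain ⟨S, hSH, hS, hspan, hU⟩ := ih H' hcov.lt
    have hle : H ≤ H' ⊔ F ∙ v := by
      refine (hcov.eq_or_eq le_sup_left
        (sup_le hcov.le ((Submodule.span_singleton_le_iff_mem v H).2 hvH))).elim (fun h => ?_)
        fun h => h.ge
      exact absurd (h.le (Submodule.mem_sup_right (Submodule.mem_span_singleton_self v))) hv
    -- Modular law: once `U` contains the new vector `v`, its trace on `H` is its trace on `H'` plus
    -- the line of `v`. If `v` is not in `U`, the trace already lies in `H'` and the induction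
    -- hypothesis suffices.
    have hsplit : ∀ U : Submodule F C, v ∈ U → U ⊓ H ≤ (U ⊓ H') ⊔ F ∙ v := by
      rintro U hvU x ⟨hxU, hxH⟩
      obtain ⟨y, hy, z, hz, rfl⟩ := Submodule.mem_sup.1 (hle hxH)
      have hzU : z ∈ U := (Submodule.span_singleton_le_iff_mem v U).2 hvU hz
      exact Submodule.add_mem_sup ⟨(Submodule.add_mem_iff_left U hzU).1 hxU, hy⟩ hz
    have hcase : ∀ U ∈ 𝓩 ∪ 𝓑, v ∈ U ∨ U ⊓ H ≤ H' := by
      rintro U (hUm | hUm)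
      · exact (hH' U hUm).imp_left fun h => h hvH
      · exact hvB U hUm
    refine ⟨insert v S, Set.insert_subset hvH (hSH.trans hcov.le), ?_, ?_, ?_⟩
    · refine hS.id_insert fun h => hv (Submodule.span_le.2 hSH h)
    · rw [Submodule.span_insert, sup_comm]
      exact hle.trans (sup_le_sup_right hspan _)
    · intro U hUm
      rcases hcase U hUm with h | h
      · refine (hsplit U h).trans (sup_le ?_ ?_)
        · exact (hU U hUm).trans (Submodule.span_mono
            (Set.inter_subset_inter_left _ (Set.subset_insert _ _)))
        · exact (Submodule.span_singleton_le_iff_mem _ _).2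
            (Submodule.subset_span ⟨Set.mem_insert _ _, h⟩)
      · exact (le_inf inf_le_left h).trans ((hU U hUm).trans (Submodule.span_mono
            (Set.inter_subset_inter_left _ (Set.subset_insert _ _))))

theorem exists_adapted_basis [FiniteDimensional F C] {𝓩 𝓑 : Set (Submodule F C)}
    (hZ : IsChain (· ≤ ·) 𝓩) (hB : IsChain (· ≤ ·) 𝓑) :
    ∃ (n : ℕ) (e : Fin n → C), LinearIndependent F e ∧
      ∀ U ∈ 𝓩 ∪ 𝓑, U ≤ Submodule.span F (e '' {i | e i ∈ U}) := by
  obtain ⟨S, -, hS, -, hU⟩ := exists_adapted_linearIndepOn hZ hB ⊤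
  have : Finite S := hS.linearIndependent.finite
  obtain ⟨n, ⟨σ⟩⟩ := Finite.exists_equiv_fin S
  refine ⟨n, fun i => σ.symm i, hS.linearIndependent.comp _ σ.symm.injective, fun U hUm => ?_⟩
  refine (le_inf le_rfl le_top).trans ((hU U hUm).trans (Submodule.span_mono ?_))
  rintro x ⟨hxS, hxU⟩
  exact ⟨σ ⟨x, hxS⟩, by simpa using hxU, by simp⟩

end AdaptedBasis

/-! ### Bases of subquotients -/

section Subquotient

variable {F : Type v} [Field F] {C : Type w} [AddCommGroup C] [Module F C]

namespace Subquotient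

/-- The class of an element of `Z` in the subquotient. -/
def mk (Z B : Submodule F C) : Z →ₗ[F] Subquotient Z B :=
  (B.submoduleOf Z).mkQ

theorem mk_surjective (Z B : Submodule F C) : Function.Surjective (mk Z B) :=
  Submodule.mkQ_surjective _

theorem ker_mk (Z B : Submodule F C) : LinearMap.ker (mk Z B) = B.submoduleOf Z :=
  Submodule.ker_mkQ _

theorem mk_eq_zero {Z B : Submodule F C} {z : Z} : mk Z B z = 0 ↔ (z : C) ∈ B := by
  rw [← LinearMap.mem_ker, ker_mk]
  rfl

theorem exists_basis {ι : Type*} {Z B : Submodule F C} {e : ι → C}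
    (he : LinearIndependent F e) (hZ : Z ≤ Submodule.span F (e '' {i | e i ∈ Z}))
    (hB : B ≤ Submodule.span F (e '' {i | e i ∈ B})) {p : ι → Prop}
    (hp : ∀ i, p i ↔ e i ∈ Z ∧ e i ∉ B) :
    ∃ b : Module.Basis {i // p i} F (Subquotient Z B),
      ∀ i, b i = mk Z B ⟨e i, ((hp i).1 i.2).1⟩ := by
  let u : {i // p i} → Z := fun i => ⟨e i, ((hp i).1 i.2).1⟩
  have hu : LinearIndependent F (mk Z B ∘ u) := by
    have hu' : LinearIndependent F u :=
      LinearIndependent.of_comp Z.subtype (he.comp _ Subtype.val_injective)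
    refine hu'.map ?_
    rw [ker_mk, Submodule.disjoint_def]
    intro x hx hxB
    have h1 : (x : C) ∈ Submodule.span F (e '' {i | p i}) := by
      have := Submodule.mem_map_of_mem (f := Z.subtype) hx
      rw [Submodule.map_span] at this
      refine Submodule.span_mono ?_ this
      rintro _ ⟨_, ⟨i, rfl⟩, rfl⟩
      exact ⟨i, i.2, rfl⟩
    have h2 := hB (show (x : C) ∈ B from hxB)
    have hd : Disjoint {i | p i} {i | e i ∈ B} :=
      Set.disjoint_left.2 fun i hi hi' => ((hp i).1 hi).2 hi'
    exact Subtype.ext (Submodule.disjoint_def.1 (he.disjoint_span_image hd) _ h1 h2)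
  refine ⟨Module.Basis.mk hu ?_, fun i => Module.Basis.mk_apply hu _ i⟩
  rintro x -
  obtain ⟨⟨x, hx⟩, rfl⟩ := mk_surjective Z B x
  -- The adapted vectors live in `C`, not in `Z`, so the span to be computed is pulled back to `Z`
  -- and pushed into `C`, where it can be tested on generators.
  have key : Z ≤ ((Submodule.span F (Set.range (mk Z B ∘ u))).comap (mk Z B)).map
      Z.subtype := by
    refine hZ.trans (Submodule.span_le.2 ?_)
    rintro _ ⟨i, hi, rfl⟩
    refine ⟨⟨e i, hi⟩, ?_, rfl⟩
    by_cases hiB : e i ∈ B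
    · have h0 : mk Z B ⟨e i, hi⟩ = 0 := mk_eq_zero.2 hiB
      rw [SetLike.mem_coe, Submodule.mem_comap, h0]
      exact Submodule.zero_mem _
    · exact Submodule.subset_span ⟨⟨i, (hp i).2 ⟨hi, hiB⟩⟩, rfl⟩
  obtain ⟨z, hz, hzx⟩ := key hx
  obtain rfl : z = ⟨x, hx⟩ := Subtype.ext hzx
  exact hz

end Subquotient

end Subquotient

/-! ### Interval decompositions from a pair of filtrations -/

/-- A function that is constant just after each parameter. -/
def RightLocallyConstant {α : Type*} (U : ℝ → α) : Prop :=
  ∀ r, ∃ s > r, ∀ t, r ≤ t → t < s → U t = U r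

/-- The threshold is the first time at which `x` lies in the filtration, or `⊤` if there is none.
Right local constancy makes the infimum attained, which is why bars are closed on the left and open
on the right. -/
theorem exists_threshold {F : Type v} [Field F] {C : Type w} [AddCommGroup C] [Module F C]
    {U : ℝ → Submodule F C} (hU : Monotone U) (hc : RightLocallyConstant U)
    (h0 : ∀ r < 0, U r = ⊥) {x : C} (hx : x ≠ 0) :
    ∃ β : EReal, β ≠ ⊥ ∧ ∀ r : ℝ, x ∈ U r ↔ β ≤ r := by
  by_cases hne : {r | x ∈ U r}.Nonempty
  · have hbdd : BddBelow {r | x ∈ U r} := by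
      refine ⟨0, fun r hr => not_lt.1 fun h => hx ?_⟩
      simpa [h0 r h] using hr
    refine ⟨(sInf {r | x ∈ U r} : ℝ), EReal.coe_ne_bot _, fun r => ?_⟩
    rw [EReal.coe_le_coe_iff]
    refine ⟨fun h => csInf_le hbdd h, fun h => hU h ?_⟩
    obtain ⟨s, hs, hsc⟩ := hc (sInf {r | x ∈ U r})
    obtain ⟨t, ht, hts⟩ := exists_lt_of_csInf_lt hne hs
    rw [← hsc t (csInf_le hbdd ht) hts]
    exact ht
  · refine ⟨⊤, by simp, fun r => ?_⟩
    simp only [top_le_iff, EReal.coe_ne_top, iff_false]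
    exact fun h => hne ⟨r, h⟩

/-- The persistence space of subquotients of two filtrations. -/
def PersistenceSpace.ofFiltrations {F : Type v} [Field F] {C : Type w} [AddCommGroup C]
    [Module F C] (Z B : ℝ → Submodule F C) (hZ : Monotone Z) (hB : Monotone B) :
    PersistenceSpace.{v, w} F where
  space r := Subquotient (Z r) (B r)
  map h := Subquotient.map (hZ h) (hB h)
  map_refl r x := by
    obtain ⟨x, rfl⟩ := Subquotient.mk_surjective _ _ x
    rfl
  map_map hrs hst x := by
    obtain ⟨x, rfl⟩ := Subquotient.mk_surjective _ _ x
    rfl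

theorem nonempty_barcode_ofFiltrations {F : Type v} [Field F] {C : Type w} [AddCommGroup C]
    [Module F C] [FiniteDimensional F C] {Z B : ℝ → Submodule F C} (hZ : Monotone Z)
    (hB : Monotone B) (hBZ : ∀ r, B r ≤ Z r) (hZc : RightLocallyConstant Z)
    (hBc : RightLocallyConstant B) (hZ0 : ∀ r < 0, Z r = ⊥) :
    Nonempty (Barcode (PersistenceSpace.ofFiltrations Z B hZ hB)) := by
  obtain ⟨n, e, he, hspan⟩ := exists_adapted_basis (F := F) (𝓩 := Set.range Z)
    (𝓑 := Set.range B) hZ.isChain_range hB.isChain_range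
  choose β hβ hβZ using fun i => exists_threshold hZ hZc hZ0 (he.ne_zero i)
  choose γ _ hγB using fun i => exists_threshold hB hBc
    (fun r hr => le_bot_iff.1 ((hBZ r).trans (hZ0 r hr).le)) (he.ne_zero i)
  -- A vector with `γ ≤ β` is never a nonzero class, since it is a boundary as soon as it is a
  -- cycle; only the others give bars.
  let ι : Type := {i : Fin n // β i ≠ ⊤ ∧ β i < γ i}
  have hcoe : ∀ i : ι, ((β i.1).toReal : EReal) = β i.1 :=
    fun i => EReal.coe_toReal i.2.1 (hβ i.1)
  have hbirth : ∀ (i : ι) (r : ℝ), (β i.1).toReal ≤ r ↔ e i.1 ∈ Z r := fun i r => by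
    rw [hβZ, ← hcoe i, EReal.coe_le_coe_iff, EReal.toReal_coe]
  have hdeath : ∀ (i : Fin n) (r : ℝ), (r : EReal) < γ i ↔ e i ∉ B r := fun i r => by
    rw [hγB, not_le]
  have hbasis : ∀ r : ℝ,
      ∃ b : Module.Basis {i : ι // (β i.1).toReal ≤ r ∧ (r : EReal) < γ i.1} F
        (Subquotient (Z r) (B r)), ∀ i, b i =
          Subquotient.mk (Z r) (B r) ⟨e i.1.1, (hbirth i.1 r).1 i.2.1⟩ := by
    intro r
    obtain ⟨b, hb⟩ := Subquotient.exists_basis (p := fun i => e i ∈ Z r ∧ e i ∉ B r) he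
      (hspan _ (Or.inl ⟨r, rfl⟩)) (hspan _ (Or.inr ⟨r, rfl⟩)) (fun i => Iff.rfl)
    let σ : {i // e i ∈ Z r ∧ e i ∉ B r} ≃
        {i : ι // (β i.1).toReal ≤ r ∧ (r : EReal) < γ i.1} :=
      { toFun := fun i =>
          have h1 : β i.1 ≤ r := (hβZ _ _).1 i.2.1
          have h2 : (r : EReal) < γ i.1 := (hdeath _ _).2 i.2.2
          ⟨⟨i.1, (h1.trans_lt (EReal.coe_lt_top r)).ne, h1.trans_lt h2⟩,
            (hbirth ⟨i.1, (h1.trans_lt (EReal.coe_lt_top r)).ne, h1.trans_lt h2⟩ r).2 i.2.1, h2⟩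
        invFun := fun i => ⟨i.1.1, (hbirth _ _).1 i.2.1, (hdeath _ _).1 i.2.2⟩
        left_inv := fun i => rfl
        right_inv := fun i => rfl }
    refine ⟨b.reindex σ, fun i => ?_⟩
    rw [Module.Basis.reindex_apply, hb]
    rfl
  choose b hb using hbasis
  exact ⟨{
    ι := ι
    birth := fun i => (β i.1).toReal
    death := fun i => γ i.1
    birth_lt_death := fun i => by
      rw [hcoe i]
      exact i.2.2
    basis := b
    map_basis_of_lt := fun {r s} h i hbi hd =>
      (congrArg (Subquotient.map (hZ h) (hB h)) (hb r _)).trans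
        (hb s ⟨i, hbi.trans h, hd⟩).symm
    map_basis_of_le := fun {r s} h i hr hd =>
      (congrArg (Subquotient.map (hZ h) (hB h)) (hb r _)).trans
        (Subquotient.mk_eq_zero.2 ((hγB _ _).2 hd)) }⟩

/-! ### Finitely many critical values -/

theorem Set.Finite.eventually_forall_le {P : Set ℝ} (hP : P.Finite) (r : ℝ) :
    ∀ᶠ t in nhds r, ∀ p ∈ P, p ≤ t → p ≤ r := by
  rw [Filter.eventually_all_finite hP]
  intro p _
  rcases le_or_gt p r with h | h
  · exact Filter.Eventually.of_forall fun _ _ => h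
  · filter_upwards [eventually_lt_nhds h] with t ht hpt using absurd hpt (not_le.2 ht)

/-- `U` is constant on intervals `[r, s]` without elements of `P` in `(r, s]`. -/
theorem RightLocallyConstant.of_finite {α : Type*} {U : ℝ → α} {P : Set ℝ} (hP : P.Finite)
    (hU : ∀ r s, r ≤ s → (∀ p ∈ P, p ≤ s → p ≤ r) → U s = U r) : RightLocallyConstant U := by
  intro r
  obtain ⟨a, s, hr, hs⟩ := mem_nhds_iff_exists_Ioo_subset.1 (hP.eventually_forall_le r)
  exact ⟨s, hr.2, fun t hrt hts => hU r t hrt (hs ⟨hr.1.trans_le hrt, hts⟩)⟩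

theorem Subquotient.map_bijective {F : Type v} [Field F] {M : Type w} [AddCommGroup M] [Module F M]
    {Z B Z' B' : Submodule F M} (hZ : Z ≤ Z') (hB : B ≤ B') (hZZ : Z' = Z) (hBB : B' = B) :
    Function.Bijective (Subquotient.map hZ hB) := by
  subst hZZ hBB
  have : ∀ x, Subquotient.map hZ hB x = x := fun x => by
    obtain ⟨x, rfl⟩ := Subquotient.mk_surjective _ _ x
    rfl
  rw [funext this]
  exact Function.bijective_id

/-- The structure maps over intervals `[r, s]` without elements of `P` in `(r, s]` are
isomorphisms. -/
def PersistenceSpace.IsConstructible {F : Type v} [Field F] (V : PersistenceSpace.{v, w} F)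
    (P : Set ℝ) : Prop :=
  ∀ ⦃r s : ℝ⦄ (h : r ≤ s), (∀ p ∈ P, p ≤ s → p ≤ r) → Function.Bijective (V.map h)

theorem PersistenceSpace.IsConstructible.mono {F : Type v} [Field F]
    {V : PersistenceSpace.{v, w} F} {P Q : Set ℝ} (hV : V.IsConstructible P) (h : P ⊆ Q) :
    V.IsConstructible Q :=
  fun _ _ hrs hQ => hV hrs fun p hp => hQ p (h hp)

/-- The set of values of a dissimilarity. -/
def Dissimilarity.values {X : Type u} (d : Dissimilarity X) : Set ℝ :=
  Set.range fun p : X × X => (d.dist p.1 p.2 : ℝ)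

theorem Dissimilarity.finite_values {X : Type u} [Finite X] (d : Dissimilarity X) :
    d.values.Finite :=
  Set.finite_range _

namespace VietorisRips

variable (F : Type v) [Field F] {X : Type u} [LinearOrder X] (d : Dissimilarity X)

theorem chains_eq_of_values {r s : ℝ} (h : r ≤ s) (hv : ∀ p ∈ d.values, p ≤ s → p ≤ r) (k : ℕ) :
    chains F d s k = chains F d r k :=
  le_antisymm (Finsupp.supported_mono fun x hx i j => hv _ ⟨(x i, x j), rfl⟩ (hx i j))
    (chains_mono F d h k)

theorem cycles_eq_of_values {r s : ℝ} (h : r ≤ s) (hv : ∀ p ∈ d.values, p ≤ s → p ≤ r) (k : ℕ) :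
    cycles F d s k = cycles F d r k := by
  cases k with
  | zero => exact chains_eq_of_values F d h hv 0
  | succ k => simp only [cycles, chains_eq_of_values F d h hv]

theorem boundaries_eq_of_values {r s : ℝ} (h : r ≤ s) (hv : ∀ p ∈ d.values, p ≤ s → p ≤ r)
    (k : ℕ) : boundaries F d s k = boundaries F d r k := by
  simp only [boundaries, chains_eq_of_values F d h hv]

theorem cycles_le_chains (r : ℝ) (k : ℕ) : cycles F d r k ≤ chains F d r k := by
  cases k with
  | zero => exact le_rfl
  | succ k => exact inf_le_left

theorem chains_eq_bot_of_neg {r : ℝ} (hr : r < 0) (k : ℕ) : chains F d r k = ⊥ := by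
  have : {x : Fin (k + 1) ↪o X | ∀ i j, (d.dist (x i) (x j) : ℝ) ≤ r} = ∅ := by
    refine Set.eq_empty_of_forall_notMem fun x hx => ?_
    exact absurd ((d.dist (x 0) (x 0)).coe_nonneg.trans (hx 0 0)) (not_le.2 hr)
  rw [chains, this, Finsupp.supported_empty]

theorem isConstructible_persistentHomology (k : ℕ) :
    (persistentHomology F d k).IsConstructible d.values := fun _ _ h hv =>
  Subquotient.map_bijective (cycles_mono F d h k) (boundaries_mono F d h k)
    (cycles_eq_of_values F d h hv k) (boundaries_eq_of_values F d h hv k)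

theorem nonempty_barcode [Finite X] (k : ℕ) : Nonempty (Barcode (persistentHomology F d k)) := by
  have : Finite (Fin (k + 1) ↪o X) := Finite.of_injective _ DFunLike.coe_injective
  exact nonempty_barcode_ofFiltrations (Z := fun r => cycles F d r k)
    (B := fun r => boundaries F d r k) (fun _ _ h => cycles_mono F d h k)
    (fun _ _ h => boundaries_mono F d h k) (fun r => boundaries_le_cycles F d r k)
    (.of_finite d.finite_values fun _ _ h hv => cycles_eq_of_values F d h hv k)
    (.of_finite d.finite_values fun _ _ h hv => boundaries_eq_of_values F d h hv k)
    (fun r hr => le_bot_iff.1 ((cycles_le_chains F d r k).trans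
      (chains_eq_bot_of_neg F d hr k).le))

end VietorisRips

/-! ### Lowering the shift of an interleaving -/

namespace ShiftMap

variable {F : Type v} [Field F] {V : PersistenceSpace.{v, w} F} {W : PersistenceSpace.{v, w'} F}
  {ε δ : ℝ≥0} {ρ : ℝ → ℝ}

/-- The components of the lowered shift map: the composite `V_r ≅ V_{ρ r} → W_{ρ r + δ}
≅ W_{ρ r + ε} → W_{r + ε}`. -/
noncomputable def lowerApp (f : ShiftMap V W δ) (hεδ : ε ≤ δ) (hle : ∀ r, ρ r ≤ r)
    (hV : ∀ r, Function.Bijective (V.map (hle r)))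
    (hW : ∀ r, Function.Bijective (W.map (add_le_add_right (NNReal.coe_le_coe.2 hεδ) (ρ r))))
    (r : ℝ) : V.space r →ₗ[F] W.space (r + ε) :=
  W.map (add_le_add_left (hle r) (ε : ℝ)) ∘ₗ (LinearEquiv.ofBijective _ (hW r)).symm.toLinearMap ∘ₗ
    f.app (ρ r) ∘ₗ (LinearEquiv.ofBijective _ (hV r)).symm.toLinearMap

theorem lowerApp_eq (f : ShiftMap V W δ) (hεδ : ε ≤ δ) (hle : ∀ r, ρ r ≤ r)
    (hV : ∀ r, Function.Bijective (V.map (hle r)))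
    (hW : ∀ r, Function.Bijective (W.map (add_le_add_right (NNReal.coe_le_coe.2 hεδ) (ρ r))))
    {r : ℝ} {x : V.space (ρ r)} {y : W.space (ρ r + ε)}
    (h : W.map (add_le_add_right (NNReal.coe_le_coe.2 hεδ) (ρ r)) y = f.app (ρ r) x) :
    f.lowerApp hεδ hle hV hW r (V.map (hle r) x) =
      W.map (add_le_add_left (hle r) (ε : ℝ)) y := by
  have h1 : (LinearEquiv.ofBijective _ (hV r)).symm (V.map (hle r) x) = x :=
    (LinearEquiv.symm_apply_eq _).2 rfl
  have h2 : (LinearEquiv.ofBijective _ (hW r)).symm (f.app (ρ r) x) = y :=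
    (LinearEquiv.symm_apply_eq _).2 h.symm
  simp only [lowerApp, LinearMap.comp_apply, LinearEquiv.coe_coe, h1, h2]

/-- A shift map by `δ` can be lowered to a shift by `ε ≤ δ` along a monotone retraction `ρ` if the
structure maps `V_{ρ r} → V_r` and `W_{ρ r + ε} → W_{ρ r + δ}` are isomorphisms. -/
noncomputable def lower (f : ShiftMap V W δ) (hεδ : ε ≤ δ) (hρ : Monotone ρ) (hle : ∀ r, ρ r ≤ r)
    (hV : ∀ r, Function.Bijective (V.map (hle r)))
    (hW : ∀ r, Function.Bijective (W.map (add_le_add_right (NNReal.coe_le_coe.2 hεδ) (ρ r)))) :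
    ShiftMap V W ε where
  app := f.lowerApp hεδ hle hV hW
  naturality {r s} h x := by
    obtain ⟨x, rfl⟩ := (hV r).2 x
    obtain ⟨y, hy⟩ := (hW r).2 (f.app _ x)
    have h1 : V.map h (V.map (hle r) x) = V.map (hle s) (V.map (hρ h) x) := by
      rw [V.map_map, V.map_map]
    rw [h1, f.lowerApp_eq hεδ hle hV hW (y := W.map (add_le_add_left (hρ h) (ε : ℝ)) y),
      f.lowerApp_eq hεδ hle hV hW hy, W.map_map, W.map_map]
    rw [f.naturality, ← hy, W.map_map, W.map_map]

/-- Only one of the two composites is treated, so that exchanging `V` and `W` gives both halves of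
an interleaving. -/
theorem lower_app_lower_app {σ : ℝ → ℝ} (f : ShiftMap V W δ) (g : ShiftMap W V δ)
    (hgf : ∀ (r : ℝ) (x : V.space r),
      g.app (r + δ) (f.app r x) = V.map (le_add_shift_twice r δ) x)
    (hεδ : ε ≤ δ) (hρ : Monotone ρ) (hle : ∀ r, ρ r ≤ r)
    (hV : ∀ r, Function.Bijective (V.map (hle r)))
    (hW : ∀ r, Function.Bijective (W.map (add_le_add_right (NNReal.coe_le_coe.2 hεδ) (ρ r))))
    (hσ : Monotone σ) (hle' : ∀ r, σ r ≤ r)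
    (hW' : ∀ r, Function.Bijective (W.map (hle' r)))
    (hV' : ∀ r, Function.Bijective (V.map (add_le_add_right (NNReal.coe_le_coe.2 hεδ) (σ r))))
    (hinj : ∀ r (h : ρ r + ε + ε ≤ ρ r + δ + δ), Function.Injective (V.map h))
    (r : ℝ) (x : V.space r) :
    (g.lower hεδ hσ hle' hW' hV').app (r + ε) ((f.lower hεδ hρ hle hV hW).app r x) =
      V.map (le_add_shift_twice r ε) x := by
  obtain ⟨x, rfl⟩ := (hV r).2 x
  obtain ⟨y, hy⟩ := (hW r).2 (f.app _ x)
  obtain ⟨z, hz⟩ := (hW' (ρ r + ε)).2 y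
  obtain ⟨t, ht⟩ := (hV' (ρ r + ε)).2 (g.app _ z)
  have hf : (f.lower hεδ hρ hle hV hW).app r (V.map (hle r) x) =
      W.map (add_le_add_left (hle r) (ε : ℝ)) y := f.lowerApp_eq hεδ hle hV hW hy
  have hg : (g.lower hεδ hσ hle' hW' hV').app (ρ r + ε) y =
      V.map (add_le_add_left (hle' (ρ r + ε)) (ε : ℝ)) t := by
    rw [← hz]
    exact g.lowerApp_eq hεδ hle' hW' hV' ht
  have hεδ' : (ε : ℝ) ≤ δ := hεδ
  have hlast : ρ r + ε + ε ≤ ρ r + δ + δ := by linarith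
  have key : V.map (add_le_add_left (hle' (ρ r + ε)) (ε : ℝ)) t =
      V.map (le_add_shift_twice (ρ r) ε) x := by
    -- At `ρ r + 2δ` the two sides agree because `g ∘ f` is a structure map; injectivity carries the
    -- equality back to `ρ r + 2ε`.
    apply hinj r hlast
    rw [V.map_map, V.map_map]
    have hq : σ (ρ r + ε) + δ ≤ ρ r + δ + δ := by linarith [hle' (ρ r + ε)]
    have hq' : σ (ρ r + ε) ≤ ρ r + δ := by linarith [hle' (ρ r + ε)]
    calc V.map _ t = V.map hq (V.map (add_le_add_right hεδ' _) t) := by rw [V.map_map]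
      _ = V.map hq (g.app _ z) := by rw [ht]
      _ = g.app _ (W.map hq' z) := (g.naturality hq' z).symm
      _ = g.app _ (f.app _ x) := by rw [← hy, ← hz, W.map_map]
      _ = _ := hgf _ x
  rw [hf, naturality, hg, key, V.map_map, V.map_map]

end ShiftMap

/-- A monotone retraction towards the largest element of a finite set below a given number. -/
theorem Set.Finite.exists_floor {P : Set ℝ} (hP : P.Finite) {K : ℝ} (hK : 0 ≤ K) :
    ∃ ρ : ℝ → ℝ, Monotone ρ ∧ (∀ r, ρ r ≤ r) ∧ (∀ r, ∀ p ∈ P, p ≤ r → p ≤ ρ r) ∧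
      ∀ r, ρ r ∈ P ∨ (ρ r + K ≤ r ∧ ∀ p ∈ P, r < p) := by
  have h : ∀ r, ∃ q ≤ r, (∀ p ∈ P, p ≤ r → p ≤ q) ∧
      (q ∈ P ∨ (q = r - K ∧ ∀ p ∈ P, r < p)) := by
    intro r
    by_cases hne : {p ∈ P | p ≤ r}.Nonempty
    · obtain ⟨q, ⟨hqP, hqr⟩, hmax⟩ := Set.exists_max_image _ id (hP.sep fun p => p ≤ r) hne
      exact ⟨q, hqr, fun p hp hpr => hmax p ⟨hp, hpr⟩, Or.inl hqP⟩
    · have hlt : ∀ p ∈ P, r < p := fun p hp => not_le.1 fun hpr => hne ⟨p, hp, hpr⟩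
      -- Below all of `P` there is no floor in `P`. Moving down by `K` keeps the whole interval from
      -- `ρ r` to `ρ r + K` below `P`.
      exact ⟨r - K, by linarith, fun p hp hpr => absurd hpr (not_le.2 (hlt p hp)),
        Or.inr ⟨rfl, hlt⟩⟩
  choose ρ hle hmax hcase using h
  refine ⟨ρ, fun r s hrs => ?_, hle, hmax, fun r => (hcase r).imp_right fun h =>
    ⟨by linarith [h.1], h.2⟩⟩
  rcases hcase r with hr | ⟨hr, hr'⟩
  · exact hmax s _ hr ((hle r).trans hrs)
  · rcases hcase s with hs | ⟨hs, -⟩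
    · linarith [hr' _ hs]
    · linarith

/-- Constructible persistence spaces with a finite set of critical values are interleaved at every
`ε` that is close enough from below to some `δ` at which they are interleaved. -/
theorem Interleaving.nonempty_of_gap {F : Type v} [Field F] {V : PersistenceSpace.{v, w} F}
    {W : PersistenceSpace.{v, w'} F} {P : Set ℝ} (hP : P.Finite) (hV : V.IsConstructible P)
    (hW : W.IsConstructible P) {ε δ : ℝ≥0} (hεδ : ε ≤ δ)
    (h1 : ∀ q ∈ P, ∀ p ∈ P, p ≤ q + δ → p ≤ q + ε)
    (h2 : ∀ q ∈ P, ∀ p ∈ P, p ≤ q + δ + δ → p ≤ q + ε + ε) (I : Interleaving V W δ) :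
    Nonempty (Interleaving V W ε) := by
  -- The gap hypotheses hold only at base points in `P`, hence the floor. The offset `2δ` makes them
  -- vacuous at base points below `P`.
  obtain ⟨ρ, hρ, hle, hmax, hcase⟩ := hP.exists_floor (K := δ + δ) (by positivity)
  have hδ := δ.coe_nonneg
  have hg1 : ∀ r, ∀ p ∈ P, p ≤ ρ r + δ → p ≤ ρ r + ε := fun r p hp hpr => by
    rcases hcase r with h | ⟨h, h'⟩
    · exact h1 _ h p hp hpr
    · linarith [h' p hp]
  have hg2 : ∀ r, ∀ p ∈ P, p ≤ ρ r + δ + δ → p ≤ ρ r + ε + ε := fun r p hp hpr => by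
    rcases hcase r with h | ⟨h, h'⟩
    · exact h2 _ h p hp hpr
    · linarith [h' p hp]
  exact ⟨{
    toRight := I.toRight.lower hεδ hρ hle (fun r => hV _ (hmax r)) (fun r => hW _ (hg1 r))
    toLeft := I.toLeft.lower hεδ hρ hle (fun r => hW _ (hmax r)) (fun r => hV _ (hg1 r))
    left_comp := ShiftMap.lower_app_lower_app _ _ I.left_comp _ _ _ _ _ _ _ _ _
      fun r h => (hV h (hg2 r)).1
    right_comp := ShiftMap.lower_app_lower_app _ _ I.right_comp _ _ _ _ _ _ _ _ _
      fun r h => (hW h (hg2 r)).1 }⟩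

theorem exists_interleaving_of_interleavingDist_lt {F : Type v} [Field F]
    {V : PersistenceSpace.{v, w} F} {W : PersistenceSpace.{v, w'} F} {a : ℝ≥0∞}
    (h : interleavingDist V W < a) :
    ∃ δ : ℝ≥0, (δ : ℝ≥0∞) < a ∧ Nonempty (Interleaving V W δ) := by
  simp only [interleavingDist, iInf_lt_iff] at h
  obtain ⟨δ, hI, hδ⟩ := h
  exact ⟨δ, hδ, hI⟩

/-- The interleaving distance of constructible persistence spaces is attained. -/
theorem nonempty_interleaving_of_interleavingDist_eq {F : Type v} [Field F]
    {V : PersistenceSpace.{v, w} F} {W : PersistenceSpace.{v, w'} F} {P : Set ℝ} (hP : P.Finite)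
    (hV : V.IsConstructible P) (hW : W.IsConstructible P) {ε : ℝ≥0}
    (hε : interleavingDist V W = ε) : Nonempty (Interleaving V W ε) := by
  -- For each of the finitely many pairs `(q, p)`, a `p` beyond `q + ε` stays beyond `q + δ` for `δ`
  -- near `ε`, and likewise for the doubled shift.
  have hgap : ∀ᶠ δ : ℝ≥0 in nhds ε, (∀ q ∈ P, ∀ p ∈ P, p ≤ q + (δ : ℝ) → p ≤ q + ε) ∧
      ∀ q ∈ P, ∀ p ∈ P, p ≤ q + (δ : ℝ) + δ → p ≤ q + ε + ε := by
    simp only [Filter.eventually_and, Filter.eventually_all_finite hP]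
    constructor
    · intro q _
      have hc : Continuous fun δ : ℝ≥0 => q + (δ : ℝ) := by fun_prop
      exact (Filter.eventually_all_finite hP).1
        (hc.continuousAt.eventually (hP.eventually_forall_le _))
    · intro q _
      have hc : Continuous fun δ : ℝ≥0 => q + (δ : ℝ) + δ := by fun_prop
      exact (Filter.eventually_all_finite hP).1
        (hc.continuousAt.eventually (hP.eventually_forall_le _))
  obtain ⟨b, hb, hsub⟩ := exists_Ico_subset_of_mem_nhds hgap ⟨ε + 1, by simp⟩
  obtain ⟨δ, hδb, hI⟩ := exists_interleaving_of_interleavingDist_lt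
    (hε.trans_lt (ENNReal.coe_lt_coe.2 hb))
  have hεδ : ε ≤ δ := by
    rw [← ENNReal.coe_le_coe, ← hε]
    exact iInf₂_le δ hI
  obtain ⟨h1, h2⟩ := hsub ⟨hεδ, ENNReal.coe_lt_coe.1 hδb⟩
  exact hI.elim (Interleaving.nonempty_of_gap hP hV hW hεδ h1 h2)

/-! ### Matching persistence pairs by Hall's theorem -/

/-- A system of distinct representatives from a matrix product that is unitriangular with respect
to a linear order on the values of `d`. -/
theorem exists_injective_mem_of_unitriangular {F ι κ α : Type*} [Field F] [LinearOrder α]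
    [DecidableEq ι] (d : ι → α) (N : ι → Finset κ) (c : ι → κ → F) (G : κ → ι → F)
    (h : ∀ i i', d i ≤ d i' → ∑ j ∈ N i, c i j * G j i' = if i = i' then 1 else 0) :
    ∃ φ : ι → κ, Function.Injective φ ∧ ∀ i, φ i ∈ N i := by
  classical
  refine (Finset.all_card_le_biUnion_card_iff_exists_injective N).1 fun A => ?_
  -- Hall's condition for `A` follows from independence of these rows: there are `A.card` of them in
  -- a space whose dimension is the number of neighbours.
  let u : A → (A.biUnion N → F) := fun i j => if (j : κ) ∈ N i then c i j else 0
  have hu : LinearIndependent F u := by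
    rw [Fintype.linearIndependent_iff]
    intro a ha
    by_contra! hne
    obtain ⟨i₀, hi₀⟩ := hne
    -- Pair the relation with the column of an `m` maximal for `d` among the indices with nonzero
    -- coefficient. Every other term vanishes by `h`, leaving `a m = 0`.
    obtain ⟨m, hm, hmax⟩ := Finset.exists_max_image (Finset.univ.filter fun i => a i ≠ 0)
      (fun i => d i) ⟨i₀, by simpa using hi₀⟩
    have hm' : a m ≠ 0 := by simpa using hm
    apply hm'
    have key : ∀ i : A, ∑ j, u i j * G j m = ∑ j ∈ N i, c i j * G j m := by
      intro i
      simp only [u, ite_mul, zero_mul]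
      rw [Finset.sum_coe_sort (A.biUnion N) (fun j => if j ∈ N i then c i j * G j m else 0),
        ← Finset.sum_filter]
      refine Finset.sum_congr ?_ fun _ _ => rfl
      ext j
      simp only [Finset.mem_filter, Finset.mem_biUnion, and_iff_right_iff_imp]
      exact fun hj => ⟨i, i.2, hj⟩
    have h0 : ∑ j, (∑ i, a i • u i) j * G j m = 0 := by
      simp only [ha, Pi.zero_apply, zero_mul, Finset.sum_const_zero]
    simp only [Finset.sum_apply, Pi.smul_apply, smul_eq_mul, Finset.sum_mul] at h0
    rw [Finset.sum_comm] at h0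
    simp only [mul_assoc, ← Finset.mul_sum] at h0
    rw [Finset.sum_eq_single m] at h0
    · rwa [key, h _ _ le_rfl, if_pos rfl, mul_one] at h0
    · intro i _ him
      by_cases hi : a i = 0
      · simp [hi]
      · rw [key, h _ _ (hmax i (by simpa using hi)), if_neg (fun e => him (Subtype.ext e)),
          mul_zero]
    · simp
  simpa using hu.fintype_card_le_finrank

namespace Barcode

variable {F : Type v} [Field F] {V : PersistenceSpace.{v, w} F} {W : PersistenceSpace.{v, w'} F}

open Classical in
/-- The coefficient of a vector of `V_r` along the summand `i`, zero if `i` is not alive at `r`. -/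
noncomputable def coeff (D : Barcode V) (r : ℝ) (i : D.ι) : V.space r →ₗ[F] F :=
  if h : D.birth i ≤ r ∧ (r : EReal) < D.death i then (D.basis r).coord ⟨i, h⟩ else 0

theorem coeff_of_alive (D : Barcode V) {r : ℝ} {i : D.ι}
    (h : D.birth i ≤ r ∧ (r : EReal) < D.death i) (x : V.space r) :
    D.coeff r i x = (D.basis r).repr x ⟨i, h⟩ := by
  simp [coeff, h]

theorem coeff_of_not_alive (D : Barcode V) {r : ℝ} {i : D.ι}
    (h : ¬(D.birth i ≤ r ∧ (r : EReal) < D.death i)) (x : V.space r) :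
    D.coeff r i x = 0 := by
  simp only [coeff, dif_neg h, LinearMap.zero_apply]

open Classical in
theorem coeff_basis (D : Barcode V) {r : ℝ} (i : D.ι)
    (j : {j : D.ι // D.birth j ≤ r ∧ (r : EReal) < D.death j}) :
    D.coeff r i (D.basis r j) = if j.1 = i then 1 else 0 := by
  by_cases h : D.birth i ≤ r ∧ (r : EReal) < D.death i
  · rw [coeff_of_alive D h, Module.Basis.repr_self, Finsupp.single_apply]
    simp only [Subtype.ext_iff]
  · rw [coeff_of_not_alive D h, if_neg]
    rintro rfl
    exact h j.2

/-- No hypothesis that `i` is born by `r` is needed: a summand born later receives nothing from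
`V_r`, in agreement with the default value zero. -/
theorem coeff_map (D : Barcode V) {r s : ℝ} (hrs : r ≤ s) {i : D.ι}
    (hs : (s : EReal) < D.death i) (x : V.space r) :
    D.coeff s i (V.map hrs x) = D.coeff r i x := by
  suffices h : D.coeff s i ∘ₗ V.map hrs = D.coeff r i from LinearMap.congr_fun h x
  refine (D.basis r).ext fun j => ?_
  rw [LinearMap.comp_apply, coeff_basis]
  obtain ⟨j, hj⟩ := j
  by_cases hd : (s : EReal) < D.death j
  · rw [D.map_basis_of_lt hrs j hj.1 hd, coeff_basis]
  · rw [D.map_basis_of_le hrs j hj (not_lt.1 hd), map_zero, if_neg]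
    rintro rfl
    exact hd hs

theorem coeff_birthVector (D : Barcode V) [DecidableEq D.ι] (i j : D.ι) :
    D.coeff (D.birth i) j (D.birthVector i) = if i = j then 1 else 0 := by
  rw [birthVector, coeff_basis]
  congr

theorem basis_eq_map_birthVector (D : Barcode V) {r : ℝ}
    (j : {j : D.ι // D.birth j ≤ r ∧ (r : EReal) < D.death j}) :
    D.basis r j = V.map j.2.1 (D.birthVector j.1) :=
  (D.map_basis_of_lt j.2.1 j.1 le_rfl j.2.2).symm

/-- Push the vector forward to the death of `j`. There `g` sends zero to zero, while the summand `i`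
is still alive or unborn at the shifted time, so its coefficient has not changed. -/
theorem coeff_app_birthVector_eq_zero (D : Barcode V) (E : Barcode W) {ε : ℝ≥0}
    (g : ShiftMap W V ε) {i : D.ι} {j : E.ι} (h : E.death j < D.death i - ((ε : ℝ) : EReal)) :
    D.coeff (E.birth j + ε) i (g.app _ (E.birthVector j)) = 0 := by
  have hb := E.birth_lt_death j
  obtain ⟨t, ht⟩ : ∃ t : ℝ, E.death j = t :=
    ⟨(E.death j).toReal, (EReal.coe_toReal h.ne_top hb.ne_bot).symm⟩
  rw [ht] at hb h
  have hbt : E.birth j ≤ t := (EReal.coe_lt_coe_iff.1 hb).le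
  have hlt : ((t + ε : ℝ) : EReal) < D.death i := by
    rw [EReal.coe_add]
    exact EReal.add_lt_of_lt_sub h
  rw [← D.coeff_map (add_le_add_left hbt (ε : ℝ)) hlt, ← g.naturality hbt, birthVector,
    E.map_basis_of_le hbt j _ ht.le, map_zero, map_zero]

/-- The coefficients of `g` are read at the births of the summands `j`, so that they form a single
matrix independent of `r`. -/
theorem coeff_app_app (D : Barcode V) (E : Barcode W) {ε : ℝ≥0} (g : ShiftMap W V ε) {r : ℝ}
    (y : W.space r) {i : D.ι} (hi : ((r + ε : ℝ) : EReal) < D.death i) :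
    D.coeff (r + ε) i (g.app r y) = ∑ j ∈ ((E.basis r).repr y).support,
      (E.basis r).repr y j * D.coeff (E.birth j.1 + ε) i (g.app _ (E.birthVector j.1)) := by
  conv_lhs => rw [← (E.basis r).linearCombination_repr y, Finsupp.linearCombination_apply,
    Finsupp.sum, map_sum, map_sum]
  refine Finset.sum_congr rfl fun j _ => ?_
  rw [map_smul, map_smul, smul_eq_mul, basis_eq_map_birthVector, g.naturality,
    D.coeff_map _ hi]

theorem lt_length_iff (D : Barcode V) (a : ℝ) (i : D.ι) :
    (a : EReal) < D.length i ↔ ((D.birth i + a : ℝ) : EReal) < D.death i := by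
  rw [length, EReal.coe_add, add_comm, EReal.lt_sub_iff_add_lt] <;> simp

/-- Pairs longer than `2ε` have distinct corresponding pairs that die at most `ε` earlier. -/
theorem exists_injective_corresponds (D : Barcode V) (E : Barcode W) {ε : ℝ≥0}
    (I : Interleaving V W ε) :
    ∃ φ : {i : D.ι // ((2 * ε : ℝ) : EReal) < D.length i} → E.ι, Function.Injective φ ∧
      ∀ i, D.Corresponds E I.toRight i.1 (φ i) ∧
        D.death i.1 - ((ε : ℝ) : EReal) ≤ E.death (φ i) := by
  classical
  let fe (i : D.ι) : W.space (D.birth i + ε) := I.toRight.app _ (D.birthVector i)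
  let N (i : {i : D.ι // ((2 * ε : ℝ) : EReal) < D.length i}) : Finset E.ι :=
    (((E.basis _).repr (fe i.1)).support.map (Function.Embedding.subtype _)).filter
      fun j => D.death i.1 - ((ε : ℝ) : EReal) ≤ E.death j
  obtain ⟨φ, hφ, hN⟩ := exists_injective_mem_of_unitriangular (F := F)
    (fun i : {i : D.ι // ((2 * ε : ℝ) : EReal) < D.length i} => D.death i.1) N
    (fun i j => E.coeff _ j (fe i.1))
    (fun j i => D.coeff (E.birth j + ε) i.1 (I.toLeft.app _ (E.birthVector j))) (by
      intro i i' hii'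
      -- This is where length `> 2ε` enters: the coefficient along `i'` can still be read after both
      -- shifts, because `i'` dies no earlier than `i`.
      have halive : ((D.birth i.1 + ε + ε : ℝ) : EReal) < D.death i'.1 := by
        have h2 : D.birth i.1 + ε + ε = D.birth i.1 + 2 * ε := by ring
        rw [h2]
        exact ((D.lt_length_iff _ _).1 i.2).trans_le hii'
      have h := D.coeff_app_app E I.toLeft (fe i.1) halive
      rw [I.left_comp, D.coeff_map _ halive, coeff_birthVector] at h
      simp only [← Subtype.ext_iff] at h
      rw [h, Finset.sum_filter, Finset.sum_map]
      refine Finset.sum_congr rfl fun j _ => ?_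
      change (if D.death i.1 - ((ε : ℝ) : EReal) ≤ E.death j.1 then E.coeff _ j.1 (fe i.1) *
        D.coeff (E.birth j.1 + ε) i'.1 (I.toLeft.app _ (E.birthVector j.1)) else 0) = _
      by_cases hj : D.death i.1 - ((ε : ℝ) : EReal) ≤ E.death j.1
      · rw [if_pos hj, E.coeff_of_alive j.2]
      -- Omitted summands die before `d_i - ε ≤ d_{i'} - ε`, so `g` has no component from them along
      -- `i'`.
      · rw [if_neg hj, D.coeff_app_birthVector_eq_zero E, mul_zero]
        exact (not_le.1 hj).trans_le (EReal.sub_le_sub hii' le_rfl))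
  refine ⟨φ, hφ, fun i => ?_⟩
  have hi := hN i
  simp only [N, Finset.mem_filter, Finset.mem_map, Finsupp.mem_support_iff] at hi
  obtain ⟨⟨⟨j, hj⟩, hne, hji⟩, hd⟩ := hi
  simp only [Function.Embedding.subtype_apply] at hji
  subst hji
  exact ⟨⟨hj, hne⟩, hd⟩

/-- Each endpoint costs at most `ε`, so a length above `4ε` leaves more than `2ε`. -/
theorem mem_selected_of_le (D : Barcode V) (E : Barcode W) {ε : ℝ≥0} {i : D.ι} {j : E.ι}
    (hi : ((4 * ε : ℝ) : EReal) < D.length i) (hb : E.birth j ≤ D.birth i + ε)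
    (hd : D.death i - ((ε : ℝ) : EReal) ≤ E.death j) : j ∈ E.selected ε := by
  rw [selected, Set.mem_ofPred_eq, lt_length_iff]
  rw [lt_length_iff] at hi
  refine lt_of_lt_of_le ?_ hd
  rw [EReal.lt_sub_iff_add_lt (by simp) (by simp), ← EReal.coe_add]
  refine lt_of_le_of_lt (EReal.coe_le_coe_iff.2 ?_) hi
  linarith

end Barcode

theorem proposition2 {F : Type v} [Field F]
    {X : Type u} [Finite X] [LinearOrder X] (dX : Dissimilarity X)
    {Y : Type w} [Finite Y] [LinearOrder Y] (dY : Dissimilarity Y)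
    (k : ℕ) (ε : ℝ≥0)
    (hε : interleavingDist (VietorisRips.persistentHomology F dX k)
      (VietorisRips.persistentHomology F dY k) = (ε : ℝ≥0∞)) :
    -- both persistence barcodes exist, and the distance is realized by an interleaving
    Nonempty (Barcode (VietorisRips.persistentHomology F dX k)) ∧
    Nonempty (Barcode (VietorisRips.persistentHomology F dY k)) ∧
    Nonempty (Interleaving (VietorisRips.persistentHomology F dX k)
      (VietorisRips.persistentHomology F dY k) ε) ∧
    -- pairs of length `> 4ε` have (distinct) corresponding pairs, and these are selected
    ∀ (D : Barcode (VietorisRips.persistentHomology F dX k))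
      (E : Barcode (VietorisRips.persistentHomology F dY k))
      (I : Interleaving (VietorisRips.persistentHomology F dX k)
        (VietorisRips.persistentHomology F dY k) ε),
      ∃ φ : {i : D.ι // ((4 * ε : ℝ) : EReal) < D.length i} → E.ι,
        Function.Injective φ ∧
        ∀ i, D.Corresponds E I.toRight i.1 (φ i) ∧
          (E.birth (φ i) : ℝ) ≤ D.birth i.1 + ε ∧
          D.death i.1 - ((ε : ℝ) : EReal) ≤ E.death (φ i) ∧
          φ i ∈ E.selected ε := by
  have hP := dX.finite_values.union dY.finite_values
  have hX := (VietorisRips.isConstructible_persistentHomology F dX k).mono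
    (Set.subset_union_left (t := dY.values))
  have hY := (VietorisRips.isConstructible_persistentHomology F dY k).mono
    (Set.subset_union_right (s := dX.values))
  refine ⟨VietorisRips.nonempty_barcode F dX k, VietorisRips.nonempty_barcode F dY k,
    nonempty_interleaving_of_interleavingDist_eq hP hX hY hε, fun D E I => ?_⟩
  obtain ⟨φ, hφ, hφD⟩ := D.exists_injective_corresponds E I
  have h42 : ((2 * ε : ℝ) : EReal) ≤ ((4 * ε : ℝ) : EReal) := by
    rw [EReal.coe_le_coe_iff]
    linarith [ε.coe_nonneg]
  refine ⟨fun i => φ ⟨i.1, h42.trans_lt i.2⟩, fun i i' h => Subtype.ext ?_, fun i => ?_⟩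
  · exact Subtype.mk.inj (hφ h)
  · obtain ⟨hc, hd⟩ := hφD ⟨i.1, h42.trans_lt i.2⟩
    have hb := hc.choose.1
    exact ⟨hc, hb, hd, D.mem_selected_of_le E i.2 hb hd⟩
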